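/- Let $I=(0,1)$, let $L^2(I)$ be the real Hilbert space of square-integrable functions for Lebesgue measure, and let $\rightharpoonup$ denote weak convergence in it. Let $\mathcal W:L^2(I)\to\mathbb R$ be continuous and weakly upper semicontinuous, i.e. $\limsup_n\mathcal W(M_n)\le\mathcal W(M)$ whenever $M_n\rightharpoonup M$. Assume moreover that one of the following holds: (a) $\mathcal W$ is periodic, i.e. $\mathcal W(M+N)=\mathcal W(M)$ for all $M\in L^2(I)$ and all integer-valued $N\in L^2(I)$, and rearrangement invariant, i.e. $\mathcal W(M\circ G)=\mathcal W(M)$ for all $M\in L^2(I)$ and all bijections $G:[0,1]\to[0,1]$ such that $G,G^{-1}$ are Borel and $G$ preserves Lebesgue measure; (b) $\mathcal W$ is bounded. Put $L(M,N)=\tfrac12\|N\|^2-\mathcal W(M)$. A curve $\sigma:[a,b]\to L^2(I)$ belongs to $AC^2(a,b;L^2(I))$ if there is $\beta\in L^2[a,b]$ with $\|\sigma(s)-\sigma(t)\|\le\int_s^t\beta(r)\,dr$ for all $a\le s\le t\le b$; such a curve has a derivative $\dot\sigma(s)$ for almost every $s$. For $v:L^2(I)\to[-\infty,+\infty]$,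 $t\ge0$ and $M\in L^2(I)$ put $$T_t^-v(M)=\inf\Big\{v(\sigma(0))+\int_0^tL(\sigma(s),\dot\sigma(s))\,ds\;:\;\sigma\in AC^2(0,t;L^2(I)),\ \sigma(t)=M\Big\}.$$ Let $\lambda\in\mathbb R$ and let $u:L^2(I)\to\mathbb R$ be weakly lower semicontinuous, i.e. $u(M)\le\liminf_n u(M_n)$ whenever $M_n\rightharpoonup M$, and suppose that $u=T_t^-u+\lambda t$ for all $t\ge0$. Then: 1. $u$ is dominated by $L+\lambda$, i.e. for all $a\le b$ and all $\sigma\in AC^2(a,b;L^2(I))$, $$u(\sigma(b))-u(\sigma(a))\le\int_a^bL(\sigma(s),\dot\sigma(s))\,ds+\lambda(b-a).$$ 2. For every $M\in L^2(I)$ there is a curve $\sigma^M:(-\infty,0]\to L^2(I)$ with $\sigma^M(0)=M$ whose restriction to $[-t,0]$ is in $AC^2(-t,0;L^2(I))$ for every $t\ge0$, and such that $$u(M)-u(\sigma^M(-t))=\int_{-t}^0L(\sigma^M(s),\dot\sigma^M(s))\,ds+\lambda t\qquad\text{for all }t\ge0.$$ -/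

import Mathlib

open Filter Topology MeasureTheory

noncomputable section

namespace WeakKAM

/-- The real Hilbert space `L²(I)`, `I = (0,1)`, with Lebesgue measure. -/
abbrev L2I : Type := Lp ℝ 2 (volume.restrict (Set.Ioo (0 : ℝ) 1))

/-- The subset `L²_ℤ(I)` of integer-valued functions (as classes of a.e. equal functions). -/
def L2Z : Set L2I :=
  {N | ∀ᵐ x ∂(volume.restrict (Set.Ioo (0 : ℝ) 1)), ∃ k : ℤ, (N : ℝ → ℝ) x = k}

/-- `u (M + N) = u M` for all `M ∈ L²(I)` and all integer-valued `N ∈ L²(I)`. -/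
def Periodic (u : L2I → ℝ) : Prop :=
  ∀ M : L2I, ∀ N ∈ L2Z, u (M + N) = u M

/-- `u (M ∘ G) = u M` for every bijection `G` of `[0,1]` that is Borel with Borel inverse and
preserves Lebesgue measure. The class of `M ∘ G` is the `N` with `N = M ∘ G` almost everywhere. -/
def RearrangementInvariant (u : L2I → ℝ) : Prop :=
  ∀ G : Set.Icc (0 : ℝ) 1 ≃ᵐ Set.Icc (0 : ℝ) 1, MeasurePreserving G volume volume →
    ∀ M N : L2I,
      (∀ᵐ x : Set.Icc (0 : ℝ) 1, (N : ℝ → ℝ) (x : ℝ) = (M : ℝ → ℝ) (G x : ℝ)) → u N = u M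

section Hilbert

variable {H : Type*} [NormedAddCommGroup H] [InnerProductSpace ℝ H]

/-- Weak convergence `M n ⇀ M₀` of a sequence. -/
def WeakConv (M : ℕ → H) (M₀ : H) : Prop :=
  Tendsto (fun n => toWeakSpace ℝ H (M n)) atTop (𝓝 (toWeakSpace ℝ H M₀))

/-- `u M₀ ≤ liminf u (M n)` whenever `M n ⇀ M₀`. The `liminf` is taken in `[-∞,+∞]`. -/
def WeaklyLSC (u : H → ℝ) : Prop :=
  ∀ (M : ℕ → H) (M₀ : H), WeakConv M M₀ →
    (u M₀ : EReal) ≤ liminf (fun n => (u (M n) : EReal)) atTop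

/-- `limsup u (M n) ≤ u M₀` whenever `M n ⇀ M₀`. The `limsup` is taken in `[-∞,+∞]`. -/
def WeaklyUSC (u : H → ℝ) : Prop :=
  ∀ (M : ℕ → H) (M₀ : H), WeakConv M M₀ →
    limsup (fun n => (u (M n) : EReal)) atTop ≤ (u M₀ : EReal)

/-- 2-absolutely continuous curves on `[a,b]`: there is `β ∈ L²[a,b]` with
`dist (σ s) (σ t) ≤ ∫ₛᵗ β` for `a ≤ s ≤ t ≤ b`. Values of `σ` outside `[a,b]` play no role. -/
def AC2 (a b : ℝ) (σ : ℝ → H) : Prop :=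
  ∃ β : ℝ → ℝ, MemLp β 2 (volume.restrict (Set.Icc a b)) ∧
    ∀ s t : ℝ, a ≤ s → s ≤ t → t ≤ b → dist (σ s) (σ t) ≤ ∫ r in s..t, β r

/-- The Lagrangian `L(M,N) = ½‖N‖² - W(M)`. -/
def lagrangian (W : H → ℝ) (M N : H) : ℝ := (1 / 2) * ‖N‖ ^ 2 - W M

/-- The action `∫ₐᵇ L(σ,σ') ds`. A 2-absolutely continuous curve in a Hilbert space is
differentiable at almost every time, so `σ'` is the ordinary derivative. -/
def action (W : H → ℝ) (a b : ℝ) (σ : ℝ → H) : ℝ :=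
  ∫ s in a..b, lagrangian W (σ s) (deriv σ s)

/-- The Lax-Oleinik operator `T_t⁻` on functions with values in `[-∞,+∞]`: the infimum of
`u (σ 0) + ∫₀ᵗ L(σ,σ') ds` over 2-absolutely continuous `σ` on `[0,t]` with `σ t = M`. -/
def laxOleinik (W : H → ℝ) (t : ℝ) (u : H → EReal) (M : H) : EReal :=
  ⨅ σ ∈ {σ : ℝ → H | AC2 0 t σ ∧ σ t = M}, u (σ 0) + ((action W 0 t σ : ℝ) : EReal)

/-- `u ≺ L + c`. -/
def Dominated (W : H → ℝ) (c : ℝ) (u : H → ℝ) : Prop :=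
  ∀ (a b : ℝ), a ≤ b → ∀ σ : ℝ → H, AC2 a b σ →
    u (σ b) - u (σ a) ≤ action W a b σ + c * (b - a)

end Hilbert

end WeakKAM

end

open Filter Topology MeasureTheory

noncomputable section

namespace WeakKAM

/-! ### Weak convergence and weak sequential compactness in Hilbert space. -/

section HilbertWeak

variable {H : Type*} [NormedAddCommGroup H] [InnerProductSpace ℝ H]

/-! Domination follows by testing the infimum that defines `laxOleinik` with a time translate of the
given curve. For calibrated curves it suffices to attain this infimum over unit time
(`exists_calibrated_unit`): minimizers are concatenated backwards from `M`, and domination on two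
adjacent intervals turns equality on their union into equality on each.

Attainment is the direct method, and needs `W` bounded. Domination along unit-speed segments gives
`u M - u N ≤ C‖M - N‖`, so in a minimizing sequence the quadratic kinetic term beats the linear gain
in `u`, and the velocities are bounded in `L²(0,1;H)`. A subsequence of velocities converges weakly;
as the endpoint is fixed, the curves converge weakly at every time. The kinetic term and `u` are
weakly lower semicontinuous, and the integral of `W` is weakly upper semicontinuous by Fatou
(`eventually_integral_comp_lt`). The argument rests on 2-absolutely continuous curves being
primitives of `L²` functions (`exists_primitive_of_dist_le_integral`).

In the periodic case boundedness is proved (`Periodic.exists_bound`). Cutting an integer-valued `N`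
by a fast square wave gives integer-valued functions converging weakly to `N/2`; iteration yields `W
0 ≤ W (2⁻ᵏ N)`, and such functions are dense, so `W 0` is the minimum. Integer translations bring
every function into the unit ball, where `W` is bounded above by weak compactness. -/

theorem weakConv_iff_inner [CompleteSpace H] {M : ℕ → H} {M₀ : H} :
    WeakConv M M₀ ↔ ∀ y, Tendsto (fun n => inner ℝ y (M n)) atTop (𝓝 (inner ℝ y M₀)) := by
  have hinj : Function.Injective ((topDualPairing ℝ H).flip) := by
    intro x y hxy
    apply ext_inner_left ℝ
    intro v
    exact DFunLike.congr_fun hxy (InnerProductSpace.toDual ℝ H v)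
  have key : WeakConv M M₀ ↔
      ∀ f : StrongDual ℝ H, Tendsto (fun n => f (M n)) atTop (𝓝 (f M₀)) :=
    WeakBilin.tendsto_iff_forall_eval_tendsto (topDualPairing ℝ H).flip hinj
  rw [key]
  constructor
  · intro h y
    exact h (InnerProductSpace.toDual ℝ H y)
  · intro h f
    obtain ⟨y, rfl⟩ := (InnerProductSpace.toDual ℝ H).surjective f
    exact h y

/-- Bounded sequences in a separable Hilbert space have weakly convergent subsequences. -/
theorem exists_subseq_weakConv [CompleteSpace H] [TopologicalSpace.SeparableSpace H]
    {M : ℕ → H} {R : ℝ} (hM : ∀ n, ‖M n‖ ≤ R) :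
    ∃ (M₀ : H) (φ : ℕ → ℕ), StrictMono φ ∧ WeakConv (M ∘ φ) M₀ := by
  obtain ⟨f, -, φ, hφ, hf⟩ := WeakDual.isSeqCompact_closedBall ℝ H 0 R
    (x := fun n => StrongDual.toWeakDual (InnerProductSpace.toDual ℝ H (M n)))
    (fun n => by simpa using hM n)
  obtain ⟨M₀, hM₀⟩ := (InnerProductSpace.toDual ℝ H).surjective (WeakDual.toStrongDual f)
  refine ⟨M₀, φ, hφ, weakConv_iff_inner.2 fun y => ?_⟩
  have := (tendsto_iff_forall_eval_tendsto_topDualPairing.1 hf) y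
  have h2 : f y = inner ℝ M₀ y := by
    have := DFunLike.congr_fun hM₀ y
    simpa using this.symm
  simp only [real_inner_comm _ y]
  rw [← h2]
  exact this

/-- Expanding `‖M₀ - M n‖² ≥ 0` gives `‖M n‖² ≥ 2⟪M₀, M n⟫ - ‖M₀‖²`, whose right side tends to
`‖M₀‖²`. -/
theorem WeakConv.eventually_norm_sq_gt [CompleteSpace H] {M : ℕ → H} {M₀ : H}
    (h : WeakConv M M₀) {ε : ℝ} (hε : 0 < ε) : ∀ᶠ n in atTop, ‖M₀‖ ^ 2 - ε < ‖M n‖ ^ 2 := by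
  have h1 := weakConv_iff_inner.1 h M₀
  rw [real_inner_self_eq_norm_sq] at h1
  filter_upwards [h1.eventually_const_lt (show ‖M₀‖ ^ 2 - ε / 2 < ‖M₀‖ ^ 2 by linarith)] with n hn
  have := norm_sub_sq_real M₀ (M n)
  nlinarith [sq_nonneg ‖M₀ - M n‖]

theorem WeaklyLSC.eventually_gt {u : H → ℝ} (hu : WeaklyLSC u) {M : ℕ → H} {M₀ : H}
    (h : WeakConv M M₀) {r : ℝ} (hr : r < u M₀) : ∀ᶠ n in atTop, r < u (M n) := by
  have h1 : (r : EReal) < liminf (fun n => (u (M n) : EReal)) atTop :=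
    (EReal.coe_lt_coe_iff.2 hr).trans_le (hu M M₀ h)
  filter_upwards [eventually_lt_of_lt_liminf h1] with n hn
  exact_mod_cast hn

theorem WeaklyUSC.eventually_lt {u : H → ℝ} (hu : WeaklyUSC u) {M : ℕ → H} {M₀ : H}
    (h : WeakConv M M₀) {r : ℝ} (hr : u M₀ < r) : ∀ᶠ n in atTop, u (M n) < r := by
  have h1 : limsup (fun n => (u (M n) : EReal)) atTop < (r : EReal) :=
    (hu M M₀ h).trans_lt (EReal.coe_lt_coe_iff.2 hr)
  filter_upwards [eventually_lt_of_limsup_lt h1] with n hn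
  exact_mod_cast hn

theorem WeaklyUSC.bddAbove_of_norm_le [CompleteSpace H] [TopologicalSpace.SeparableSpace H]
    {u : H → ℝ} (hu : WeaklyUSC u) (R : ℝ) : ∃ K, ∀ M, ‖M‖ ≤ R → u M ≤ K := by
  by_contra! hc
  choose M hM hMu using fun n : ℕ => hc n
  obtain ⟨M₀, φ, hφ, hw⟩ := exists_subseq_weakConv hM
  obtain ⟨k, hk⟩ := exists_nat_gt (u M₀ + 1)
  obtain ⟨n, h1, h2⟩ := ((hu.eventually_lt hw (lt_add_one _)).and (eventually_ge_atTop k)).exists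
  have h3 : (k : ℝ) ≤ φ n := by exact_mod_cast h2.trans (hφ.id_le n)
  have := hMu (φ n)
  simp only [Function.comp] at h1
  linarith

/-- Pairing the integral with `y` is pairing `g n` with the function equal to `y` on `s` and to zero
elsewhere. This turns weak convergence of velocities into weak convergence of positions. -/
theorem WeakConv.setIntegral [CompleteSpace H] {α : Type*} [MeasurableSpace α] {μ : Measure α}
    {g : ℕ → Lp H 2 μ} {g₀ : Lp H 2 μ} (h : WeakConv g g₀) {s : Set α} (hs : MeasurableSet s)
    (hμs : μ s ≠ ⊤) : WeakConv (fun n => ∫ x in s, g n x ∂μ) (∫ x in s, g₀ x ∂μ) := by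
  rw [weakConv_iff_inner] at h ⊢
  intro y
  have := h (indicatorConstLp 2 hs hμs y)
  simpa only [L2.inner_indicatorConstLp_eq_inner_setIntegral] using this

theorem WeakConv.const_sub [CompleteSpace H] {M : ℕ → H} {M₀ : H} (h : WeakConv M M₀) (c : H) :
    WeakConv (fun n => c - M n) (c - M₀) := by
  rw [weakConv_iff_inner] at h ⊢
  intro y
  simp only [inner_sub_right]
  exact tendsto_const_nhds.sub (h y)

theorem WeakConv.unique_of_tendsto [CompleteSpace H] {M : ℕ → H} {M₀ M₁ : H} (h : WeakConv M M₀)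
    (h1 : Tendsto M atTop (𝓝 M₁)) : M₀ = M₁ := by
  rw [weakConv_iff_inner] at h
  refine ext_inner_left ℝ fun v => ?_
  exact tendsto_nhds_unique (h v) (tendsto_const_nhds.inner h1)

end HilbertWeak

open scoped ENNReal
-- The Radon-Nikodym property: absolutely continuous curves are primitives.
section RadonNikodym

/-- Tonelli: a given `r` is counted for the `s` in `[r - h, r)`, a set of length `h`. -/
theorem lintegral_lintegral_Ioc_add {F : ℝ → ℝ≥0∞} (hF : Measurable F) (h : ℝ) :
    ∫⁻ s, ∫⁻ r in Set.Ioc s (s + h), F r = ENNReal.ofReal h * ∫⁻ r, F r := by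
  have hS : MeasurableSet {p : ℝ × ℝ | p.1 < p.2 ∧ p.2 ≤ p.1 + h} :=
    (measurableSet_lt measurable_fst measurable_snd).inter
      (measurableSet_le measurable_snd (measurable_fst.add_const h))
  have h1 : ∀ s, ∫⁻ r in Set.Ioc s (s + h), F r =
      ∫⁻ r, {p : ℝ × ℝ | p.1 < p.2 ∧ p.2 ≤ p.1 + h}.indicator (fun p => F p.2) (s, r) := by
    intro s
    rw [← lintegral_indicator measurableSet_Ioc]
    rfl
  have h2 : ∀ r, ∫⁻ s, {p : ℝ × ℝ | p.1 < p.2 ∧ p.2 ≤ p.1 + h}.indicator (fun p => F p.2) (s, r) =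
      ENNReal.ofReal h * F r := by
    intro r
    have : ∀ s, {p : ℝ × ℝ | p.1 < p.2 ∧ p.2 ≤ p.1 + h}.indicator (fun p => F p.2) (s, r) =
        (Set.Ico (r - h) r).indicator (fun _ => F r) s := by
      intro s
      have : (s, r) ∈ {p : ℝ × ℝ | p.1 < p.2 ∧ p.2 ≤ p.1 + h} ↔ s ∈ Set.Ico (r - h) r := by
        simp only [Set.mem_ofPred_eq, Set.mem_Ico]
        constructor <;> rintro ⟨a, b⟩ <;> constructor <;> linarith
      by_cases hs : s ∈ Set.Ico (r - h) r
      · rw [Set.indicator_of_mem hs, Set.indicator_of_mem (this.2 hs)]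
      · rw [Set.indicator_of_notMem hs, Set.indicator_of_notMem (fun h' => hs (this.1 h'))]
    simp_rw [this]
    rw [lintegral_indicator measurableSet_Ico, lintegral_const, Measure.restrict_apply_univ,
      Real.volume_Ico, mul_comm]
    congr 2
    ring
  simp_rw [h1]
  rw [lintegral_lintegral_swap]
  · simp_rw [h2]
    rw [lintegral_const_mul _ hF]
  · exact ((hF.comp measurable_snd).indicator hS).aemeasurable

theorem sq_lintegral_le {α : Type*} [MeasurableSpace α] (μ : Measure α) {F : α → ℝ≥0∞}
    (hF : AEMeasurable F μ) : (∫⁻ x, F x ∂μ) ^ 2 ≤ μ Set.univ * ∫⁻ x, F x ^ 2 ∂μ := by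
  have h := ENNReal.lintegral_mul_le_Lp_mul_Lq μ Real.HolderConjugate.two_two
    (f := fun _ => 1) (g := F) aemeasurable_const hF
  simp only [Pi.mul_apply, one_mul, ENNReal.one_rpow, lintegral_one] at h
  calc (∫⁻ x, F x ∂μ) ^ 2
      ≤ ((μ Set.univ) ^ (1 / 2 : ℝ) * (∫⁻ x, F x ^ (2 : ℝ) ∂μ) ^ (1 / 2 : ℝ)) ^ 2 := by gcongr
    _ = _ := by
      rw [mul_pow, ← ENNReal.rpow_natCast, ← ENNReal.rpow_natCast, ← ENNReal.rpow_mul,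
        ← ENNReal.rpow_mul]
      norm_num

theorem eLpNorm_two_sq {α E : Type*} [MeasurableSpace α] [NormedAddCommGroup E] {μ : Measure α}
    (f : α → E) : eLpNorm f 2 μ ^ 2 = ∫⁻ x, ‖f x‖ₑ ^ 2 ∂μ := by
  have := eLpNorm_nnreal_pow_eq_lintegral (μ := μ) (f := f) (p := 2) (by norm_num)
  simpa using this

theorem continuous_of_dist_le_integral {X : Type*} [PseudoMetricSpace X] {σ : ℝ → X} {β : ℝ → ℝ}
    (hβ : MemLp β 2 volume)
    (hσ : ∀ s t, s ≤ t → dist (σ s) (σ t) ≤ ∫ r in s..t, β r) : Continuous σ := by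
  have hi : ∀ a b, IntervalIntegrable β volume a b := fun a b =>
    ((hβ.locallyIntegrable (by norm_num)).integrableOn_isCompact isCompact_uIcc).intervalIntegrable
  have hc := intervalIntegral.continuous_primitive hi 0
  have key : ∀ s t, dist (σ s) (σ t) ≤ dist (∫ r in (0 : ℝ)..s, β r) (∫ r in (0 : ℝ)..t, β r) := by
    intro s t
    wlog hst : s ≤ t generalizing s t
    · rw [dist_comm, dist_comm (∫ r in (0 : ℝ)..s, β r)]
      exact this t s (le_of_not_ge hst)
    · refine (hσ s t hst).trans ?_
      rw [dist_comm, Real.dist_eq, intervalIntegral.integral_interval_sub_left (hi _ _) (hi _ _)]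
      exact le_abs_self _
  rw [Metric.continuous_iff] at hc ⊢
  intro b ε hε
  obtain ⟨δ, hδ, h⟩ := hc b ε hε
  exact ⟨δ, hδ, fun a ha => (key a b).trans_lt (h a ha)⟩

variable {H : Type*} [NormedAddCommGroup H] [InnerProductSpace ℝ H]

/-- Cauchy-Schwarz on each window `(s, s + h]`, then Tonelli in `s`. The bound is uniform in `h`, so
difference quotients have weak limits. -/
theorem eLpNorm_slope_le {σ : ℝ → H} {β : ℝ → ℝ} (hβ : MemLp β 2 volume)
    (hσ : ∀ s t, s ≤ t → dist (σ s) (σ t) ≤ ∫ r in s..t, β r) {h : ℝ} (hh : 0 < h) :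
    eLpNorm (fun s => h⁻¹ • (σ (s + h) - σ s)) 2 volume ≤ eLpNorm β 2 volume := by
  wlog hm : StronglyMeasurable β generalizing β
  · have e := hβ.1.ae_eq_mk
    rw [eLpNorm_congr_ae e]
    refine this ((memLp_congr_ae e).1 hβ) ?_ hβ.1.stronglyMeasurable_mk
    intro s t hst
    refine (hσ s t hst).trans_eq ?_
    exact intervalIntegral.integral_congr_ae (e.mono fun x hx _ => hx)
  have hm' : Measurable fun r => ‖β r‖ₑ := hm.measurable.enorm
  rw [← ENNReal.pow_le_pow_left_iff two_ne_zero, eLpNorm_two_sq, eLpNorm_two_sq]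
  have hpt : ∀ s, ‖h⁻¹ • (σ (s + h) - σ s)‖ₑ ^ 2 ≤
      (ENNReal.ofReal h)⁻¹ * ∫⁻ r in Set.Ioc s (s + h), ‖β r‖ₑ ^ 2 := by
    intro s
    have h1 : ‖σ (s + h) - σ s‖ₑ ≤ ∫⁻ r in Set.Ioc s (s + h), ‖β r‖ₑ := by
      have h2 := hσ s (s + h) (by linarith)
      rw [intervalIntegral.integral_of_le (by linarith), dist_comm, dist_eq_norm] at h2
      calc ‖σ (s + h) - σ s‖ₑ ≤ ‖∫ r in Set.Ioc s (s + h), β r‖ₑ := by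
            rw [enorm_le_iff_norm_le]
            exact h2.trans (le_abs_self _)
        _ ≤ _ := enorm_integral_le_lintegral_enorm _
    have h3 : ‖h⁻¹‖ₑ = (ENNReal.ofReal h)⁻¹ := by
      rw [Real.enorm_of_nonneg (inv_nonneg.2 hh.le), ENNReal.ofReal_inv_of_pos hh]
    have hh0 : ENNReal.ofReal h ≠ 0 := by simpa using hh
    rw [enorm_smul, mul_pow, h3]
    calc (ENNReal.ofReal h)⁻¹ ^ 2 * ‖σ (s + h) - σ s‖ₑ ^ 2
        ≤ (ENNReal.ofReal h)⁻¹ ^ 2 * (∫⁻ r in Set.Ioc s (s + h), ‖β r‖ₑ) ^ 2 := by gcongr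
      _ ≤ (ENNReal.ofReal h)⁻¹ ^ 2 *
          (ENNReal.ofReal h * ∫⁻ r in Set.Ioc s (s + h), ‖β r‖ₑ ^ 2) := by
          gcongr
          have := sq_lintegral_le (volume.restrict (Set.Ioc s (s + h))) hm'.aemeasurable
          simpa using this
      _ = _ := by
          rw [← mul_assoc, sq, mul_assoc (ENNReal.ofReal h)⁻¹,
            ENNReal.inv_mul_cancel hh0 ENNReal.ofReal_ne_top, mul_one]
  have hh0 : ENNReal.ofReal h ≠ 0 := by simpa using hh
  calc _ ≤ ∫⁻ s, (ENNReal.ofReal h)⁻¹ * ∫⁻ r in Set.Ioc s (s + h), ‖β r‖ₑ ^ 2 :=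
        lintegral_mono hpt
    _ = _ := by
      rw [lintegral_const_mul' _ _ (by simpa using hh),
        lintegral_lintegral_Ioc_add (hm'.pow_const 2), ← mul_assoc,
        ENNReal.inv_mul_cancel hh0 ENNReal.ofReal_ne_top, one_mul]

/-- A curve in a separable Hilbert space whose increments are controlled by the integral of an `L²`
function is the primitive of an `L²` function. -/
theorem exists_primitive_of_dist_le_integral [CompleteSpace H] [SecondCountableTopology H]
    {σ : ℝ → H} {β : ℝ → ℝ} (hβ : MemLp β 2 volume)
    (hσ : ∀ s t, s ≤ t → dist (σ s) (σ t) ≤ ∫ r in s..t, β r) :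
    ∃ g : ℝ → H, MemLp g 2 volume ∧ ∀ s t, s ≤ t → σ t - σ s = ∫ r in s..t, g r := by
  have hc : Continuous σ := continuous_of_dist_le_integral hβ hσ
  set h : ℕ → ℝ := fun n => 1 / ((n : ℝ) + 1) with hdef
  have hpos : ∀ n, 0 < h n := fun n => Nat.one_div_pos_of_nat
  have hlim : Tendsto h atTop (𝓝[>] 0) :=
    tendsto_nhdsWithin_iff.2 ⟨tendsto_one_div_add_atTop_nhds_zero_nat, .of_forall hpos⟩
  have hmem : ∀ n, MemLp (fun s => (h n)⁻¹ • (σ (s + h n) - σ s)) 2 volume := fun n =>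
    ⟨(by fun_prop : Continuous _).aestronglyMeasurable,
      (eLpNorm_slope_le hβ hσ (hpos n)).trans_lt hβ.2⟩
  have hbd : ∀ n, ‖(hmem n).toLp _‖ ≤ (eLpNorm β 2 volume).toReal := fun n => by
    rw [Lp.norm_toLp]
    exact ENNReal.toReal_mono hβ.2.ne (eLpNorm_slope_le hβ hσ (hpos n))
  -- Separability of `Lp H 2`, needed for weak compactness, is inferred from this fact.
  have : Fact ((2 : ℝ≥0∞) ≠ ⊤) := ⟨by norm_num⟩
  obtain ⟨g, φ, hφ, hw⟩ := exists_subseq_weakConv hbd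
  refine ⟨g, Lp.memLp g, fun s t hst => ?_⟩
  have hw2 := hw.setIntegral (s := Set.Ioc s t) measurableSet_Ioc (by simp)
  rw [intervalIntegral.integral_of_le hst]
  refine (hw2.unique_of_tendsto ?_).symm
  have hσi : ∀ a b, IntervalIntegrable σ volume a b := fun a b => hc.intervalIntegrable a b
  -- The integrated difference quotient telescopes to the averages of `σ` over short windows
  -- starting at `t` and at `s`; these converge by continuity.
  have heq : ∀ n, ∫ x in Set.Ioc s t, ((hmem n).toLp _ : ℝ → H) x =
      (h n)⁻¹ • (∫ x in t..(t + h n), σ x) - (h n)⁻¹ • ∫ x in s..(s + h n), σ x := by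
    intro n
    rw [setIntegral_congr_ae measurableSet_Ioc ((hmem n).coeFn_toLp.mono fun x hx _ => hx),
      ← intervalIntegral.integral_of_le hst, intervalIntegral.integral_smul,
      intervalIntegral.integral_sub ((by fun_prop : Continuous fun x => σ (x + h n)).intervalIntegrable _ _)
        (hσi _ _), intervalIntegral.integral_comp_add_right, ← smul_sub]
    congr 1
    rw [sub_eq_sub_iff_add_eq_add, add_comm,
      intervalIntegral.integral_add_adjacent_intervals (hσi _ _) (hσi _ _),
      add_comm (∫ x in t..(t + h n), σ x),
      intervalIntegral.integral_add_adjacent_intervals (hσi _ _) (hσi _ _)]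
  have hder : ∀ t, Tendsto (fun n => (h n)⁻¹ • ∫ x in t..(t + h n), σ x) atTop (𝓝 (σ t)) := by
    intro t
    have := (hc.integral_hasStrictDerivAt t t).hasDerivAt.tendsto_slope_zero_right
    have := this.comp hlim
    simpa [Function.comp_def] using this
  have := (hder t).sub (hder s)
  simp only [Function.comp_def, heq]
  exact this.comp hφ.tendsto_atTop

end RadonNikodym

/-! ### Calculus of 2-absolutely continuous curves and of the action. -/

section Curves

variable {H : Type*} [NormedAddCommGroup H]

theorem intervalIntegrable_of_memLp_two {E : Type*} [NormedAddCommGroup E] {g : ℝ → E} {a b : ℝ}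
    (hg : MemLp g 2 (volume.restrict (Set.Ioc a b))) {s t : ℝ} (hs : s ∈ Set.Icc a b)
    (ht : t ∈ Set.Icc a b) : IntervalIntegrable g volume s t := by
  have h : IntegrableOn g (Set.Ioc a b) volume := hg.integrable (by norm_num)
  rw [intervalIntegrable_iff]
  refine h.mono_set ?_
  rw [Set.uIoc]
  exact Set.Ioc_subset_Ioc (le_min hs.1 ht.1) (max_le hs.2 ht.2)

theorem AC2.mono {a b c d : ℝ} {σ : ℝ → H} (h : AC2 a b σ) (hac : a ≤ c) (hdb : d ≤ b) :
    AC2 c d σ := by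
  obtain ⟨β, hβ, hσ⟩ := h
  exact ⟨β, hβ.mono_measure (Measure.restrict_mono (Set.Icc_subset_Icc hac hdb) le_rfl),
    fun s t hs hst ht => hσ s t (hac.trans hs) hst (ht.trans hdb)⟩

theorem AC2.congr {a b : ℝ} {σ τ : ℝ → H} (h : AC2 a b σ) (e : Set.EqOn τ σ (Set.Icc a b)) :
    AC2 a b τ := by
  obtain ⟨β, hβ, hσ⟩ := h
  refine ⟨β, hβ, fun s t hs hst ht => ?_⟩
  rw [e ⟨hs, hst.trans ht⟩, e ⟨hs.trans hst, ht⟩]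
  exact hσ s t hs hst ht

theorem AC2.comp_add_right {a b : ℝ} {σ : ℝ → H} (h : AC2 a b σ) (c : ℝ) :
    AC2 (a - c) (b - c) (fun s => σ (s + c)) := by
  obtain ⟨β, hβ, hσ⟩ := h
  refine ⟨fun s => β (s + c), ?_, fun s t hs hst ht => ?_⟩
  · have := hβ.comp_measurePreserving
      ((measurePreserving_add_right volume c).restrict_preimage
        (measurableSet_Icc (a := a) (b := b)))
    simpa [Function.comp_def] using this
  · rw [intervalIntegral.integral_comp_add_right]
    exact hσ _ _ (by linarith) (by linarith) (by linarith)

theorem AC2.union {a b c : ℝ} {σ : ℝ → H} (h₁ : AC2 a b σ) (h₂ : AC2 b c σ) (hab : a ≤ b)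
    (hbc : b ≤ c) : AC2 a c σ := by
  obtain ⟨β, hβ, hσ⟩ := h₁
  obtain ⟨γ, hγ, hτ⟩ := h₂
  rw [← Measure.restrict_congr_set Ioc_ae_eq_Icc] at hβ hγ
  set δ : ℝ → ℝ := (Set.Iic b).piecewise β γ with hδ
  have e₁ : ∀ s t, s ≤ t → t ≤ b → ∫ r in s..t, δ r = ∫ r in s..t, β r := by
    intro s t hst ht
    rw [intervalIntegral.integral_of_le hst, intervalIntegral.integral_of_le hst]
    refine setIntegral_congr_fun measurableSet_Ioc fun x hx => ?_
    simp [hδ, hx.2.trans ht]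
  have e₂ : ∀ s t, s ≤ t → b ≤ s → ∫ r in s..t, δ r = ∫ r in s..t, γ r := by
    intro s t hst ht
    rw [intervalIntegral.integral_of_le hst, intervalIntegral.integral_of_le hst]
    refine setIntegral_congr_fun measurableSet_Ioc fun x hx => ?_
    simp [hδ, ht.trans_lt hx.1]
  have hm : MemLp δ 2 (volume.restrict (Set.Ioc a c)) := by
    refine MemLp.piecewise measurableSet_Iic ?_ ?_
    · rw [Measure.restrict_restrict measurableSet_Iic]
      refine hβ.mono_measure (Measure.restrict_mono ?_ le_rfl)
      rintro x ⟨hx, hx'⟩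
      exact ⟨hx'.1, hx⟩
    · rw [Measure.restrict_restrict measurableSet_Iic.compl]
      refine hγ.mono_measure (Measure.restrict_mono ?_ le_rfl)
      rintro x ⟨hx, hx'⟩
      exact ⟨not_le.1 hx, hx'.2⟩
  refine ⟨δ, by rwa [← Measure.restrict_congr_set Ioc_ae_eq_Icc], fun s t hs hst ht => ?_⟩
  rcases le_total t b with htb | htb
  · rw [e₁ s t hst htb]
    exact hσ s t hs hst htb
  rcases le_total b s with hbs | hbs
  · rw [e₂ s t hst hbs]
    exact hτ s t hbs hst ht
  rw [← intervalIntegral.integral_add_adjacent_intervals (b := b)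
    (intervalIntegrable_of_memLp_two hm ⟨hs, hst.trans ht⟩ ⟨hab, hbc⟩)
    (intervalIntegrable_of_memLp_two hm ⟨hab, hbc⟩ ⟨hs.trans hst, ht⟩),
    e₁ s b hbs le_rfl, e₂ b t htb le_rfl]
  exact (dist_triangle _ (σ b) _).trans
    (add_le_add (hσ s b hs hbs le_rfl) (hτ b t le_rfl htb ht))

variable [InnerProductSpace ℝ H]

/-- `σ` is on `[a,b]` the primitive of the `L²` function `g`. -/
def IsPrimitiveOn (a b : ℝ) (σ g : ℝ → H) : Prop :=
  MemLp g 2 (volume.restrict (Set.Ioc a b)) ∧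
    ∀ s ∈ Set.Icc a b, σ s = σ b - ∫ r in s..b, g r

theorem IsPrimitiveOn.sub_eq {a b : ℝ} {σ g : ℝ → H} (h : IsPrimitiveOn a b σ g) {s t : ℝ}
    (hs : s ∈ Set.Icc a b) (ht : t ∈ Set.Icc a b) : σ t - σ s = ∫ r in s..t, g r := by
  have hb : b ∈ Set.Icc a b := ⟨hs.1.trans hs.2, le_rfl⟩
  rw [h.2 s hs, h.2 t ht, sub_sub_sub_cancel_left, intervalIntegral.integral_interval_sub_interval_comm']
  · rw [intervalIntegral.integral_same, zero_sub, intervalIntegral.integral_symm, neg_neg]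
  · exact intervalIntegrable_of_memLp_two h.1 hs hb
  · exact intervalIntegrable_of_memLp_two h.1 ht hb
  · exact intervalIntegrable_of_memLp_two h.1 hs ht

theorem IsPrimitiveOn.ac2 {a b : ℝ} {σ g : ℝ → H} (h : IsPrimitiveOn a b σ g) : AC2 a b σ := by
  refine ⟨fun r => ‖g r‖, ?_, fun s t hs hst ht => ?_⟩
  · rw [← Measure.restrict_congr_set Ioc_ae_eq_Icc]
    exact h.1.norm
  · rw [dist_comm, dist_eq_norm, h.sub_eq ⟨hs, hst.trans ht⟩ ⟨hs.trans hst, ht⟩]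
    exact intervalIntegral.norm_integral_le_integral_norm hst

theorem IsPrimitiveOn.continuousOn [CompleteSpace H] {a b : ℝ} {σ g : ℝ → H}
    (h : IsPrimitiveOn a b σ g) : ContinuousOn σ (Set.Icc a b) := by
  rcases lt_or_ge b a with hab | hab
  · simp [Set.Icc_eq_empty_of_lt hab]
  have hi := intervalIntegrable_of_memLp_two h.1 (Set.left_mem_Icc.2 hab) (Set.right_mem_Icc.2 hab)
  have hc := intervalIntegral.continuousOn_primitive_interval' hi Set.left_mem_uIcc
  rw [Set.uIcc_of_le hab] at hc
  refine (hc.const_add (σ a)).congr fun s hs => ?_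
  have := h.sub_eq (Set.left_mem_Icc.2 hab) hs
  simp [← this]

theorem IsPrimitiveOn.ae_hasDerivAt [CompleteSpace H] {a b : ℝ} {σ g : ℝ → H}
    (h : IsPrimitiveOn a b σ g) (hab : a ≤ b) :
    ∀ᵐ s ∂(volume.restrict (Set.Ioc a b)), HasDerivAt σ (g s) s := by
  have hi := intervalIntegrable_of_memLp_two h.1 (Set.left_mem_Icc.2 hab) (Set.right_mem_Icc.2 hab)
  rw [← Measure.restrict_congr_set Ioo_ae_eq_Ioc, ae_restrict_iff' measurableSet_Ioo]
  filter_upwards [hi.ae_hasDerivAt_integral] with s hs hs'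
  have h1 := hs (by rw [Set.uIcc_of_le hab]; exact Set.Ioo_subset_Icc_self hs') a Set.left_mem_uIcc
  refine (h1.const_add (σ a)).congr_of_eventuallyEq ?_
  filter_upwards [Ioo_mem_nhds hs'.1 hs'.2] with x hx
  have := h.sub_eq (Set.left_mem_Icc.2 hab) (Set.Ioo_subset_Icc_self hx)
  simp [← this]

theorem AC2.exists_isPrimitiveOn [CompleteSpace H] [SecondCountableTopology H] {a b : ℝ}
    {σ : ℝ → H} (h : AC2 a b σ) (hab : a ≤ b) : ∃ g, IsPrimitiveOn a b σ g := by
  obtain ⟨β, hβ, hσ⟩ := h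
  have hβ' : MemLp ((Set.Icc a b).indicator fun r => ‖β r‖) 2 volume :=
    (memLp_indicator_iff_restrict measurableSet_Icc).2 hβ.norm
  have hi : ∀ s t, IntervalIntegrable ((Set.Icc a b).indicator fun r => ‖β r‖) volume s t :=
    fun s t => ((hβ'.locallyIntegrable
      (by norm_num)).integrableOn_isCompact isCompact_uIcc).intervalIntegrable
  -- Freezing the curve outside `[a,b]` extends it to the whole line, with `‖β‖` extended by zero;
  -- the norm makes the integral monotone in its domain.
  set p : ℝ → ℝ := fun s => max a (min b s) with hp
  have hpmem : ∀ s, p s ∈ Set.Icc a b := fun s =>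
    ⟨le_max_left _ _, max_le hab (min_le_left _ _)⟩
  have hpmono : Monotone p := fun s t hst => max_le_max le_rfl (min_le_min le_rfl hst)
  have hpid : ∀ s ∈ Set.Icc a b, p s = s := fun s hs => by simp [hp, hs.1, hs.2]
  obtain ⟨g, hg, hgσ⟩ := exists_primitive_of_dist_le_integral (σ := σ ∘ p) hβ' (by
    intro s t hst
    refine (hσ (p s) (p t) (hpmem s).1 (hpmono hst) (hpmem t).2).trans ?_
    rw [intervalIntegral.integral_of_le hst, intervalIntegral.integral_of_le (hpmono hst)]
    calc ∫ r in Set.Ioc (p s) (p t), β r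
        ≤ ∫ r in Set.Ioc (p s) (p t), ‖β r‖ :=
          (Real.le_norm_self _).trans (norm_integral_le_integral_norm _)
      _ = ∫ r in Set.Ioc (p s) (p t), (Set.Icc a b).indicator (fun r => ‖β r‖) r := by
          refine setIntegral_congr_fun measurableSet_Ioc fun x hx => ?_
          have : x ∈ Set.Icc a b := ⟨(hpmem s).1.trans hx.1.le, hx.2.trans (hpmem t).2⟩
          simp only [Set.indicator_of_mem this]
      _ ≤ _ := by
          refine setIntegral_mono_set ?_ ?_ (LE.le.eventuallyLE ?_)
          · exact (intervalIntegrable_iff_integrableOn_Ioc_of_le hst).1 (hi s t)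
          · exact .of_forall fun x => Set.indicator_nonneg (fun _ _ => norm_nonneg _) x
          · rintro x ⟨hx1, hx2⟩
            simp only [hp, max_lt_iff, min_lt_iff, le_max_iff, le_min_iff] at hx1 hx2
            rcases hx2 with hx2 | hx2
            · exact absurd hx1.1 (not_lt.2 hx2)
            · rcases hx1.2 with hx3 | hx3
              · exact absurd hx3 (not_lt.2 hx2.1)
              · exact ⟨hx3, hx2.2⟩)
  refine ⟨g, hg.mono_measure Measure.restrict_le_self, fun s hs => ?_⟩
  have := hgσ s b hs.2
  simp only [Function.comp, hpid s hs, hpid b (Set.right_mem_Icc.2 hab)] at this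
  rw [← this]
  abel

theorem IsPrimitiveOn.intervalIntegrable_comp [CompleteSpace H] {W : H → ℝ} (hW : Continuous W)
    {a b : ℝ} {σ g : ℝ → H} (h : IsPrimitiveOn a b σ g) (hab : a ≤ b) :
    IntervalIntegrable (fun s => W (σ s)) volume a b := by
  refine ContinuousOn.intervalIntegrable ?_
  rw [Set.uIcc_of_le hab]
  exact hW.comp_continuousOn h.continuousOn

theorem IsPrimitiveOn.lagrangian_ae [CompleteSpace H] {a b : ℝ} {σ g : ℝ → H}
    (h : IsPrimitiveOn a b σ g) (hab : a ≤ b) (W : H → ℝ) :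
    (fun s => lagrangian W (σ s) (deriv σ s)) =ᵐ[volume.restrict (Set.Ioc a b)]
      fun s => (1 / 2) * ‖g s‖ ^ 2 - W (σ s) := by
  filter_upwards [h.ae_hasDerivAt hab] with s hs
  rw [hs.deriv, lagrangian]

theorem IsPrimitiveOn.intervalIntegrable_norm_sq {a b : ℝ} {σ g : ℝ → H}
    (h : IsPrimitiveOn a b σ g) (hab : a ≤ b) :
    IntervalIntegrable (fun s => (1 / 2) * ‖g s‖ ^ 2) volume a b := by
  rw [intervalIntegrable_iff_integrableOn_Ioc_of_le hab]
  exact ((memLp_two_iff_integrable_sq_norm h.1.1).1 h.1).const_mul _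

theorem IsPrimitiveOn.action_eq [CompleteSpace H] {W : H → ℝ} (hW : Continuous W) {a b : ℝ}
    {σ g : ℝ → H} (h : IsPrimitiveOn a b σ g) (hab : a ≤ b) :
    action W a b σ = (1 / 2) * (∫ s in Set.Ioc a b, ‖g s‖ ^ 2) - ∫ s in a..b, W (σ s) := by
  rw [action, intervalIntegral.integral_of_le hab, integral_congr_ae (h.lagrangian_ae hab W),
    ← intervalIntegral.integral_of_le hab, intervalIntegral.integral_sub
      (h.intervalIntegrable_norm_sq hab) (h.intervalIntegrable_comp hW hab),
    intervalIntegral.integral_const_mul, intervalIntegral.integral_of_le hab]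

theorem action_congr {W : H → ℝ} {a b : ℝ} (hab : a ≤ b) {σ τ : ℝ → H}
    (e : Set.EqOn τ σ (Set.Ioo a b)) : action W a b τ = action W a b σ := by
  rw [action, action, intervalIntegral.integral_of_le hab, intervalIntegral.integral_of_le hab,
    ← Measure.restrict_congr_set Ioo_ae_eq_Ioc]
  refine setIntegral_congr_fun measurableSet_Ioo fun s hs => ?_
  have : τ =ᶠ[𝓝 s] σ := e.eventuallyEq_of_mem (Ioo_mem_nhds hs.1 hs.2)
  simp only [this.deriv_eq, e hs]

theorem action_comp_add_right (W : H → ℝ) (a b c : ℝ) (σ : ℝ → H) :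
    action W (a - c) (b - c) (fun s => σ (s + c)) = action W a b σ := by
  have : ∀ s, deriv (fun s => σ (s + c)) s = deriv σ (s + c) := fun s =>
    deriv_comp_add_const σ c s
  simp only [action, this]
  rw [intervalIntegral.integral_comp_add_right (fun s => lagrangian W (σ s) (deriv σ s))]
  simp

variable [CompleteSpace H] [SecondCountableTopology H]

theorem AC2.intervalIntegrable_lagrangian {W : H → ℝ} (hW : Continuous W) {a b : ℝ} {σ : ℝ → H}
    (h : AC2 a b σ) (hab : a ≤ b) :
    IntervalIntegrable (fun s => lagrangian W (σ s) (deriv σ s)) volume a b := by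
  obtain ⟨g, hg⟩ := h.exists_isPrimitiveOn hab
  have := (hg.intervalIntegrable_norm_sq hab).sub (hg.intervalIntegrable_comp hW hab)
  rw [intervalIntegrable_iff_integrableOn_Ioc_of_le hab] at this ⊢
  exact this.congr (hg.lagrangian_ae hab W).symm

theorem action_add {W : H → ℝ} (hW : Continuous W) {a b c : ℝ} {σ : ℝ → H} (h₁ : AC2 a b σ)
    (h₂ : AC2 b c σ) (hab : a ≤ b) (hbc : b ≤ c) :
    action W a c σ = action W a b σ + action W b c σ :=
  (intervalIntegral.integral_add_adjacent_intervals (h₁.intervalIntegrable_lagrangian hW hab)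
    (h₂.intervalIntegrable_lagrangian hW hbc)).symm

end Curves

/-! ### Domination, and minimizers over unit time. -/

section FixedPoint

variable {H : Type*} [NormedAddCommGroup H] [InnerProductSpace ℝ H]

theorem dominated_of_laxOleinik {W u : H → ℝ} {lam : ℝ}
    (hfix : ∀ t : ℝ, 0 ≤ t → ∀ M : H,
      (u M : EReal) = laxOleinik W t (fun N => (u N : EReal)) M + ((lam * t : ℝ) : EReal)) :
    Dominated W lam u := by
  intro a b hab σ hσ
  have h1 := hσ.comp_add_right a
  rw [sub_self] at h1
  have h2 : laxOleinik W (b - a) (fun N => (u N : EReal)) (σ b) ≤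
      (u (σ a) : EReal) + ((action W a b σ : ℝ) : EReal) := by
    refine (iInf₂_le (fun s => σ (s + a)) ⟨h1, by simp⟩).trans_eq ?_
    have := action_comp_add_right W a b a σ
    rw [sub_self] at this
    simp only [this, zero_add]
  have h3 : (u (σ b) : EReal) ≤
      ((u (σ a) + action W a b σ + lam * (b - a) : ℝ) : EReal) := by
    rw [hfix (b - a) (by linarith) (σ b)]
    push_cast
    gcongr
  have := EReal.coe_le_coe_iff.1 h3
  linarith

/-- The fixed-point equation with `u M` real keeps the infimum finite, so near-minimizers exist. -/
theorem exists_lt_of_laxOleinik {W u : H → ℝ} {lam t : ℝ} {M : H}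
    (hfix : (u M : EReal) = laxOleinik W t (fun N => (u N : EReal)) M + ((lam * t : ℝ) : EReal))
    {ε : ℝ} (hε : 0 < ε) :
    ∃ σ, AC2 0 t σ ∧ σ t = M ∧ u (σ 0) + action W 0 t σ + lam * t < u M + ε := by
  by_contra! hc
  have h : ((u M + ε - lam * t : ℝ) : EReal) ≤ laxOleinik W t (fun N => (u N : EReal)) M := by
    refine le_iInf₂ fun σ hσ => ?_
    have := hc σ hσ.1 hσ.2
    have h' : u M + ε - lam * t ≤ u (σ 0) + action W 0 t σ := by linarith
    simpa only [← EReal.coe_add, EReal.coe_le_coe_iff] using h'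
  have h2 : ((u M + ε : ℝ) : EReal) ≤ u M := by
    rw [hfix]
    calc ((u M + ε : ℝ) : EReal) = ((u M + ε - lam * t : ℝ) : EReal) + ((lam * t : ℝ) : EReal) := by
          rw [← EReal.coe_add]; congr 1; ring
      _ ≤ _ := by gcongr
  have := EReal.coe_le_coe_iff.1 h2
  linarith

theorem abs_integral_comp_le {X : Type*} {W : X → ℝ} {K : ℝ} (hK : ∀ M, |W M| ≤ K) (f : ℝ → X)
    {T : ℝ} (hT : 0 ≤ T) : |∫ s in (0 : ℝ)..T, W (f s)| ≤ K * T := by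
  have h := intervalIntegral.norm_integral_le_of_norm_le_const (a := 0) (b := T) (C := K)
    (f := fun s => W (f s)) fun x _ => by rw [Real.norm_eq_abs]; exact hK _
  rwa [Real.norm_eq_abs, sub_zero, abs_of_nonneg hT] at h

theorem norm_setIntegral_le_norm {μ : Measure ℝ} [IsProbabilityMeasure μ] (g : Lp H 2 μ)
    (s : Set ℝ) : ‖∫ r in s, g r ∂μ‖ ≤ ‖g‖ := by
  have hm : MemLp g 2 μ := Lp.memLp g
  have hi : Integrable g μ := hm.integrable (by norm_num)
  have h1 : (∫ r, ‖g r‖ ∂μ) = (eLpNorm g 1 μ).toReal := by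
    rw [eLpNorm_one_eq_lintegral_enorm, integral_norm_eq_lintegral_enorm hi.1]
  calc ‖∫ r in s, g r ∂μ‖ ≤ ∫ r in s, ‖g r‖ ∂μ := norm_integral_le_integral_norm _
    _ ≤ ∫ r, ‖g r‖ ∂μ := setIntegral_le_integral hi.norm (.of_forall fun _ => norm_nonneg _)
    _ ≤ ‖g‖ := by
      rw [h1, Lp.norm_def]
      exact ENNReal.toReal_mono hm.2.ne (eLpNorm_le_eLpNorm_of_exponent_le (by norm_num) hm.1)

theorem integral_norm_sq_eq {μ : Measure ℝ} (g : Lp H 2 μ) : ∫ r, ‖g r‖ ^ 2 ∂μ = ‖g‖ ^ 2 := by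
  rw [← real_inner_self_eq_norm_sq g, L2.inner_def]
  simp only [real_inner_self_eq_norm_sq]

/-- Fatou's lemma for the nonnegative functions `K - W (τ n s)`. -/
theorem eventually_integral_comp_lt {W : H → ℝ} (hWc : Continuous W) (hWusc : WeaklyUSC W) {K : ℝ}
    (hK : ∀ M, |W M| ≤ K) {τ : ℕ → ℝ → H} {σ : ℝ → H}
    (hτ : ∀ n, ContinuousOn (τ n) (Set.Icc 0 1)) (hσ : ContinuousOn σ (Set.Icc 0 1))
    (hw : ∀ s ∈ Set.Icc (0 : ℝ) 1, WeakConv (fun n => τ n s) (σ s)) {ε : ℝ} (hε : 0 < ε) :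
    ∀ᶠ n in atTop, ∫ s in (0 : ℝ)..1, W (τ n s) < (∫ s in (0 : ℝ)..1, W (σ s)) + ε := by
  set μ := volume.restrict (Set.Ioc (0 : ℝ) 1) with hμ
  have hint : ∀ {f : ℝ → H}, ContinuousOn f (Set.Icc 0 1) → Integrable (fun s => W (f s)) μ := by
    intro f hf
    have := (hWc.comp_continuousOn hf).integrableOn_Icc (μ := volume)
    exact this.mono_set Set.Ioc_subset_Icc_self
  have hnn : ∀ M, 0 ≤ K - W M := fun M => by linarith [(abs_le.1 (hK M)).2]
  have hconv : ∀ {f : ℝ → H}, ContinuousOn f (Set.Icc 0 1) →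
      ENNReal.ofReal (K - ∫ s in (0 : ℝ)..1, W (f s)) = ∫⁻ s, ENNReal.ofReal (K - W (f s)) ∂μ := by
    intro f hf
    rw [← ofReal_integral_eq_lintegral_ofReal (f := fun s => K - W (f s)) ((integrable_const K).sub (hint hf))
      (.of_forall fun s => hnn _), integral_sub (integrable_const K) (hint hf),
      intervalIntegral.integral_of_le zero_le_one]
    simp [hμ]
  have hnn' : ∀ {f : ℝ → H}, ContinuousOn f (Set.Icc 0 1) →
      0 ≤ K - ∫ s in (0 : ℝ)..1, W (f s) := by
    intro f hf
    have h3 := (abs_le.1 (abs_integral_comp_le hK f zero_le_one)).2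
    linarith
  -- If the limit integral equals its largest possible value `K`, the claim is immediate; otherwise
  -- positivity permits a strict comparison under `ENNReal.ofReal`.
  rcases eq_or_lt_of_le (hnn' hσ) with h0 | h0
  · filter_upwards with n
    linarith [hnn' (hτ n)]
  have hfatou : ∫⁻ s, ENNReal.ofReal (K - W (σ s)) ∂μ ≤
      liminf (fun n => ∫⁻ s, ENNReal.ofReal (K - W (τ n s)) ∂μ) atTop := by
    refine le_trans ?_ (lintegral_liminf_le' fun n =>
      (((integrable_const K).sub (hint (hτ n))).aestronglyMeasurable.aemeasurable).ennreal_ofReal)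
    refine lintegral_mono_ae ?_
    rw [hμ, ae_restrict_iff' measurableSet_Ioc]
    refine .of_forall fun s hs => ?_
    refine le_of_forall_lt fun c hc => ?_
    obtain ⟨d, hcd, hd⟩ := exists_between hc
    refine hcd.trans_le (le_liminf_of_le (by isBoundedDefault) ?_)
    have hdtop : d ≠ ⊤ := (hd.trans ENNReal.ofReal_lt_top).ne
    rw [← ENNReal.ofReal_toReal hdtop] at hd ⊢
    have hd' := (ENNReal.ofReal_lt_ofReal_iff_of_nonneg ENNReal.toReal_nonneg).1 hd
    filter_upwards [hWusc.eventually_lt (hw s (Set.Ioc_subset_Icc_self hs))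
      (show W (σ s) < K - d.toReal by linarith)] with n hn
    exact ENNReal.ofReal_le_ofReal (by linarith)
  rw [← hconv hσ] at hfatou
  have h1 : ENNReal.ofReal (K - (∫ s in (0 : ℝ)..1, W (σ s)) - ε) <
      ENNReal.ofReal (K - ∫ s in (0 : ℝ)..1, W (σ s)) :=
    (ENNReal.ofReal_lt_ofReal_iff h0).2 (by linarith)
  filter_upwards [eventually_lt_of_lt_liminf (h1.trans_le hfatou)] with n hn
  rw [← hconv (hτ n)] at hn
  by_contra! hcon
  exact hn.not_ge (ENNReal.ofReal_le_ofReal (by linarith))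

variable [CompleteSpace H]

/-- Domination along the segment from `N` to `M` run at unit speed, in time `‖M - N‖`. -/
theorem Dominated.sub_le {W u : H → ℝ} {lam K : ℝ} (hu : Dominated W lam u) (hWc : Continuous W)
    (hK : ∀ M, |W M| ≤ K) (M N : H) : u M - u N ≤ (1 / 2 + K + lam) * ‖M - N‖ := by
  rcases eq_or_ne M N with rfl | hMN
  · simp
  set T := ‖M - N‖ with hT
  have hT0 : 0 < T := norm_pos_iff.2 (sub_ne_zero.2 hMN)
  set σ : ℝ → H := fun s => N + (s / T) • (M - N) with hσ
  have hσT : σ T = M := by simp [hσ, hT0.ne']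
  have hσ0 : σ 0 = N := by simp [hσ]
  have hp : IsPrimitiveOn 0 T σ (fun _ => T⁻¹ • (M - N)) := by
    refine ⟨memLp_const _, fun s _ => ?_⟩
    rw [intervalIntegral.integral_const, hσT, smul_smul, sub_mul, sub_smul,
      mul_inv_cancel₀ hT0.ne', one_smul]
    simp only [hσ, div_eq_mul_inv]
    abel
  have h1 := hu 0 T hT0.le σ hp.ac2
  rw [hp.action_eq hWc hT0.le, hσT, hσ0] at h1
  have h2 : ∫ s in Set.Ioc 0 T, ‖T⁻¹ • (M - N)‖ ^ 2 = T := by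
    have : ‖T⁻¹ • (M - N)‖ = 1 := by
      rw [norm_smul, ← hT, Real.norm_of_nonneg (inv_nonneg.2 hT0.le), inv_mul_cancel₀ hT0.ne']
    simp [this, hT0.le]
  have := (abs_le.1 (abs_integral_comp_le hK σ hT0.le)).1
  rw [h2] at h1
  linarith

variable [SecondCountableTopology H]

/-- Existence of minimizers of the Lax-Oleinik problem over a unit time interval. -/
theorem exists_calibrated_unit {W u : H → ℝ} {lam K : ℝ} (hWc : Continuous W)
    (hWusc : WeaklyUSC W) (hK : ∀ M, |W M| ≤ K) (hu : WeaklyLSC u) {M : H}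
    (hfix : ∀ t : ℝ, 0 ≤ t → ∀ M : H,
      (u M : EReal) = laxOleinik W t (fun N => (u N : EReal)) M + ((lam * t : ℝ) : EReal)) :
    ∃ σ, AC2 0 1 σ ∧ σ 1 = M ∧ u M - u (σ 0) = action W 0 1 σ + lam := by
  have hD := dominated_of_laxOleinik hfix
  set μ := volume.restrict (Set.Ioc (0 : ℝ) 1) with hμ
  have : IsProbabilityMeasure μ := ⟨by simp [hμ]⟩
  choose τ hτ hτM hτu using fun n : ℕ =>
    exists_lt_of_laxOleinik (hfix 1 zero_le_one M) (Nat.one_div_pos_of_nat (α := ℝ) (n := n))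
  choose g hg using fun n => (hτ n).exists_isPrimitiveOn zero_le_one
  set γ : ℕ → Lp H 2 μ := fun n => (hg n).1.toLp with hγ
  have hIoc : ∀ s ∈ Set.Icc (0 : ℝ) 1, ∀ f : ℝ → H,
      ∫ r in s..1, f r = ∫ r in Set.Ioc s 1, f r ∂μ := by
    intro s hs f
    rw [intervalIntegral.integral_of_le hs.2, hμ, Measure.restrict_restrict measurableSet_Ioc,
      Set.inter_eq_left.2 (Set.Ioc_subset_Ioc_left hs.1)]
  have hτγ : ∀ n, ∀ s ∈ Set.Icc (0 : ℝ) 1, τ n s = M - ∫ r in Set.Ioc s 1, γ n r ∂μ := by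
    intro n s hs
    rw [(hg n).2 s hs, hτM, hIoc s hs]
    congr 1
    exact integral_congr_ae (ae_restrict_of_ae (hg n).1.coeFn_toLp.symm)
  have hact : ∀ n, action W 0 1 (τ n) =
      (1 / 2) * ‖γ n‖ ^ 2 - ∫ s in (0 : ℝ)..1, W (τ n s) := by
    intro n
    rw [(hg n).action_eq hWc zero_le_one, ← integral_norm_sq_eq (γ n)]
    congr 2
    exact integral_congr_ae ((hg n).1.coeFn_toLp.symm.mono fun x hx => by simp only [hγ, hx])
  have hWint : ∀ f : ℝ → H, |∫ s in (0 : ℝ)..1, W (f s)| ≤ K := by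
    intro f
    simpa using abs_integral_comp_le hK f zero_le_one
  set C := |1 / 2 + K + lam| with hC
  -- With `D = 2 * (1 + K + |lam|)`, near-minimality gives `x² ≤ 2Cx + D` for `x = ‖γ n‖`, which
  -- excludes `x > 2C + D + 1`.
  have hbd : ∀ n, ‖γ n‖ ≤ 2 * C + 2 * (1 + K + |lam|) + 1 := by
    intro n
    have h1 := hτu n
    have h2 : u M - u (τ n 0) ≤ C * ‖γ n‖ := by
      refine (hD.sub_le hWc hK M (τ n 0)).trans ?_
      have h3 : ‖M - τ n 0‖ ≤ ‖γ n‖ := by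
        rw [hτγ n 0 (by simp), sub_sub_cancel]
        exact norm_setIntegral_le_norm _ _
      calc _ ≤ C * ‖M - τ n 0‖ := by gcongr; exact le_abs_self _
        _ ≤ _ := by gcongr
    have h4 := (abs_le.1 (hWint (τ n))).2
    have h5 : (1 : ℝ) / ((n : ℝ) + 1) ≤ 1 := by
      rw [div_le_one (by positivity)]
      linarith [n.cast_nonneg (α := ℝ)]
    rw [hact] at h1
    have h6 : ‖γ n‖ ^ 2 ≤ 2 * C * ‖γ n‖ + 2 * (1 + K + |lam|) := by
      linarith [neg_abs_le lam]
    have hC0 : 0 ≤ C := abs_nonneg _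
    have hK0 : 0 ≤ K := (abs_nonneg _).trans (hK M)
    have hl := abs_nonneg lam
    by_contra! hcon
    nlinarith [norm_nonneg (γ n)]
  have : Fact ((2 : ENNReal) ≠ ⊤) := ⟨by norm_num⟩
  obtain ⟨γ₀, φ, hφ, hw⟩ := exists_subseq_weakConv hbd
  set σ : ℝ → H := fun s => M - ∫ r in s..1, γ₀ r with hσ
  have hp : IsPrimitiveOn 0 1 σ γ₀ := ⟨Lp.memLp γ₀, fun s _ => by simp [hσ]⟩
  have hσ1 : σ 1 = M := by simp [hσ]
  have hpw : ∀ s ∈ Set.Icc (0 : ℝ) 1, WeakConv (fun n => τ (φ n) s) (σ s) := by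
    intro s hs
    have := (hw.setIntegral (s := Set.Ioc s 1) measurableSet_Ioc (measure_ne_top _ _)).const_sub M
    simp only [hσ, hIoc s hs, hτγ _ s hs]
    exact this
  refine ⟨σ, hp.ac2, hσ1, le_antisymm ?_ ?_⟩
  · have := hD 0 1 zero_le_one σ hp.ac2
    rw [hσ1] at this
    linarith
  refine le_of_forall_pos_le_add fun ε hε => ?_
  -- Four errors of at most `ε / 4`: kinetic energy, initial value, potential, and the defect of
  -- minimality.
  have e1 := hw.eventually_norm_sq_gt (show 0 < ε / 4 by linarith)
  have e2 := hu.eventually_gt (hpw 0 (by simp)) (show u (σ 0) - ε / 4 < u (σ 0) by linarith)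
  have e3 := eventually_integral_comp_lt hWc hWusc hK (fun n => (hg (φ n)).continuousOn)
    hp.continuousOn hpw (show 0 < ε / 4 by linarith)
  have e4 := (tendsto_one_div_add_atTop_nhds_zero_nat (𝕜 := ℝ)).comp hφ.tendsto_atTop
  have e4 := e4.eventually_lt_const (show 0 < ε / 4 by linarith)
  obtain ⟨n, h1, h2, h3, h4⟩ := (e1.and (e2.and (e3.and e4))).exists
  have h5 := hτu (φ n)
  rw [hact] at h5
  simp only [Function.comp] at h1 h4
  rw [hp.action_eq hWc zero_le_one, integral_norm_sq_eq γ₀]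
  linarith

end FixedPoint

/-! ### Concatenation of minimizers into a curve on the half-line. -/

section Calibrated

variable {H : Type*} [NormedAddCommGroup H] [InnerProductSpace ℝ H] [CompleteSpace H]
  [SecondCountableTopology H]

/-- A curve calibrated on `[-n,0]` is calibrated on `[-t,0]` for `t ≤ n`. -/
theorem Dominated.calibrated_of_le {W u : H → ℝ} {lam : ℝ} (hD : Dominated W lam u)
    (hWc : Continuous W) {σ : ℝ → H} {n t : ℝ} (hσ : AC2 (-n) 0 σ) (ht : 0 ≤ t) (htn : t ≤ n)
    (hn : u (σ 0) - u (σ (-n)) = action W (-n) 0 σ + lam * n) :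
    u (σ 0) - u (σ (-t)) = action W (-t) 0 σ + lam * t := by
  have h₁ : AC2 (-n) (-t) σ := hσ.mono le_rfl (by linarith)
  have h₂ : AC2 (-t) 0 σ := hσ.mono (by linarith) le_rfl
  have d₁ := hD (-n) (-t) (by linarith) σ h₁
  have d₂ := hD (-t) 0 (by linarith) σ h₂
  -- Subtracting `d₁` from the equality on `[-n,0]` gives the inequality opposite to `d₂`.
  rw [action_add hWc h₁ h₂ (by linarith) (by linarith)] at hn
  linarith

/-- Calibrated curves over unit time intervals concatenate to a curve calibrated on `(-∞,0]`. -/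
theorem exists_calibrated_of_unit {W u : H → ℝ} {lam : ℝ} (hD : Dominated W lam u)
    (hWc : Continuous W)
    (hunit : ∀ M, ∃ σ, AC2 0 1 σ ∧ σ 1 = M ∧ u M - u (σ 0) = action W 0 1 σ + lam) (M : H) :
    ∃ σ : ℝ → H, σ 0 = M ∧ (∀ t : ℝ, 0 ≤ t → AC2 (-t) 0 σ) ∧
      ∀ t : ℝ, 0 ≤ t → u M - u (σ (-t)) = action W (-t) 0 σ + lam * t := by
  choose τ hτ hτ1 hτu using hunit
  let x : ℕ → H := fun n => Nat.rec M (fun _ y => τ y 0) n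
  have hx : ∀ n, x (n + 1) = τ (x n) 0 := fun n => rfl
  -- On `(-(n+1), -n]` the floor is `n`, and the minimizer ending at `x n` is run. At `-(n+1)` the
  -- next piece takes over, with the same value `x (n + 1) = τ (x n) 0`.
  let σ : ℝ → H := fun s => τ (x ⌊-s⌋₊) (s + (⌊-s⌋₊ + 1))
  have hσx : ∀ n : ℕ, σ (-n) = x n := fun n => by
    simp only [σ, neg_neg, Nat.floor_natCast, neg_add_cancel_left, hτ1]
  have hσ0 : σ 0 = M := by
    have := hσx 0
    rwa [Nat.cast_zero, neg_zero] at this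
  have heq : ∀ n : ℕ, Set.EqOn σ (fun s => τ (x n) (s + (n + 1)))
      (Set.Icc (-((n + 1 : ℕ) : ℝ)) (-n)) := by
    intro n s hs
    rcases eq_or_lt_of_le hs.1 with h | h
    · rw [← h, hσx, hx]
      push_cast
      simp
    · have : ⌊-s⌋₊ = n := by
        push_cast at h
        rw [Nat.floor_eq_iff (by linarith [hs.2, n.cast_nonneg (α := ℝ)])]
        exact ⟨by linarith [hs.2], by linarith⟩
      simp only [σ, this]
  have hle : ∀ n : ℕ, -((n + 1 : ℕ) : ℝ) ≤ -n := fun n => by push_cast; linarith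
  have hpiece : ∀ n : ℕ, AC2 (-((n + 1 : ℕ) : ℝ)) (-n) σ := by
    intro n
    refine AC2.congr ?_ (heq n)
    have := (hτ (x n)).comp_add_right (n + 1)
    rw [zero_sub, show (1 : ℝ) - (n + 1) = -n by ring] at this
    simpa only [Nat.cast_add, Nat.cast_one] using this
  have hpact : ∀ n : ℕ, u (σ (-n)) - u (σ (-((n + 1 : ℕ) : ℝ))) =
      action W (-((n + 1 : ℕ) : ℝ)) (-n) σ + lam := by
    intro n
    rw [action_congr (hle n) ((heq n).mono Set.Ioo_subset_Icc_self), hσx, hσx, hx, hτu]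
    have := action_comp_add_right W 0 1 (n + 1) (τ (x n))
    rw [zero_sub, show (1 : ℝ) - (n + 1) = -n by ring] at this
    simp only [← this, Nat.cast_add, Nat.cast_one]
  have hnat : ∀ n : ℕ, AC2 (-n) 0 σ ∧ u (σ 0) - u (σ (-n)) = action W (-n) 0 σ + lam * n := by
    intro n
    induction n with
    | zero =>
      refine ⟨⟨0, MemLp.zero, fun s t hs hst ht => ?_⟩, by simp [action]⟩
      have h1 : s = t := le_antisymm hst (by simp at hs; linarith)
      simp [h1]
    | succ n ih =>
      have hn : -(n : ℝ) ≤ 0 := by simp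
      refine ⟨(hpiece n).union ih.1 (hle n) hn, ?_⟩
      have := hpact n
      rw [action_add hWc (hpiece n) ih.1 (hle n) hn]
      have h2 := ih.2
      push_cast at this ⊢
      linarith
  refine ⟨σ, hσ0, fun t ht => ?_, fun t ht => ?_⟩
  · obtain ⟨n, hn⟩ := exists_nat_ge t
    exact (hnat n).1.mono (by linarith) le_rfl
  · obtain ⟨n, hn⟩ := exists_nat_ge t
    have := hD.calibrated_of_le hWc (hnat n).1 ht hn (hnat n).2
    rwa [hσ0] at this

end Calibrated

/-! ### Boundedness of periodic weakly upper semicontinuous functionals. -/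

section Periodic

/-- Continuity of translations in `L¹`. -/
theorem tendsto_norm_toLp_translate_sub {h : ℝ → ℝ} (hh : MemLp h 1 volume) {c : ℕ → ℝ}
    (hc : Tendsto c atTop (𝓝 0)) :
    Tendsto (fun n => ∫ x, ‖h (c n + x) - h x‖) atTop (𝓝 0) := by
  have : Fact ((1 : ENNReal) ≠ ⊤) := ⟨by norm_num⟩
  have h1 : Continuous fun t : ℝ => (DomAddAct.mk t +ᵥ hh.toLp h : Lp ℝ 1 volume) :=
    (DomAddAct.continuous_mk.vadd continuous_const)
  have h2 := ((h1.tendsto 0).comp hc).sub_const (hh.toLp h)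
  have h0 : (DomAddAct.mk (0 : ℝ) +ᵥ hh.toLp h : Lp ℝ 1 volume) = hh.toLp h := by
    rw [DomAddAct.mk_zero, zero_vadd]
  rw [h0, sub_self] at h2
  have h3 := h2.norm
  rw [norm_zero] at h3
  refine h3.congr fun n => ?_
  rw [Function.comp, L1.norm_eq_integral_norm]
  refine integral_congr_ae ?_
  rw [DomAddAct.mk_vadd_toLp, ← MemLp.toLp_sub]
  filter_upwards [MemLp.coeFn_toLp ((hh.comp_measurePreserving
    (measurePreserving_vadd (c n) volume)).sub hh)] with x hx
  exact (congrArg norm hx).trans (by simp)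

/-- The support of the square wave of period `2`. -/
def evenFloor : Set ℝ := {x | Even ⌊x⌋}

theorem measurableSet_evenFloor : MeasurableSet evenFloor :=
  Int.measurable_floor (MeasurableSet.of_discrete (s := {k : ℤ | Even k}))

theorem add_one_mem_evenFloor_iff (x : ℝ) : x + 1 ∈ evenFloor ↔ x ∉ evenFloor := by
  simp [evenFloor]

/-- The sets `{x | ⌊(n+1)x⌋ is even}`. -/
def oscSet (n : ℕ) : Set ℝ := {x | ((n : ℝ) + 1) * x ∈ evenFloor}

theorem measurableSet_oscSet (n : ℕ) : MeasurableSet (oscSet n) :=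
  (measurable_const_mul ((n : ℝ) + 1)) measurableSet_evenFloor

theorem translate_mem_oscSet_iff (n : ℕ) (x : ℝ) :
    1 / ((n : ℝ) + 1) + x ∈ oscSet n ↔ x ∉ oscSet n := by
  have : ((n : ℝ) + 1) * (1 / ((n : ℝ) + 1) + x) = ((n : ℝ) + 1) * x + 1 := by
    field_simp
    ring
  simp only [oscSet, Set.mem_ofPred_eq, this, add_one_mem_evenFloor_iff]

/-- Translation by `1 / (n + 1)` exchanges `oscSet n` and its complement, so the integrals of `h`
over the two differ by at most the `L¹` distance from `h` to its translate. -/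
theorem tendsto_integral_indicator_oscSet {h : ℝ → ℝ} (hh : Integrable h) :
    Tendsto (fun n => ∫ x, (oscSet n).indicator h x) atTop (𝓝 ((1 / 2) * ∫ x, h x)) := by
  have hlim := tendsto_norm_toLp_translate_sub (memLp_one_iff_integrable.2 hh)
    (tendsto_one_div_add_atTop_nhds_zero_nat (𝕜 := ℝ))
  rw [tendsto_iff_norm_sub_tendsto_zero]
  refine squeeze_zero (fun _ => norm_nonneg _) (fun n => ?_) hlim
  set c := 1 / ((n : ℝ) + 1) with hc
  have hE := measurableSet_oscSet n
  have hi := hh.indicator hE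
  have hi' := hh.indicator hE.compl
  have hic : Integrable (fun x => (oscSet n)ᶜ.indicator (fun x => h (c + x)) x) :=
    (hh.comp_add_left c).indicator hE.compl
  have e1 : ∫ x, (oscSet n).indicator h x = ∫ x, (oscSet n)ᶜ.indicator (fun x => h (c + x)) x := by
    rw [← integral_add_left_eq_self _ c]
    congr 1
    ext x
    by_cases hx : x ∈ oscSet n
    · rw [Set.indicator_of_notMem, Set.indicator_of_notMem (by simpa using hx)]
      exact fun h' => (translate_mem_oscSet_iff n x).1 h' hx
    · rw [Set.indicator_of_mem ((translate_mem_oscSet_iff n x).2 hx),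
        Set.indicator_of_mem (by simpa using hx)]
  have e2 : ∫ x, h x = (∫ x, (oscSet n).indicator h x) + ∫ x, (oscSet n)ᶜ.indicator h x := by
    rw [← integral_add hi hi']
    congr 1
    ext x
    exact (Set.indicator_self_add_compl_apply (oscSet n) h x).symm
  have e3 : (∫ x, (oscSet n).indicator h x) - 1 / 2 * ∫ x, h x =
      (1 / 2) * ∫ x, (oscSet n)ᶜ.indicator (fun x => h (c + x) - h x) x := by
    have : ∀ x, (oscSet n)ᶜ.indicator (fun x => h (c + x) - h x) x =
        (oscSet n)ᶜ.indicator (fun x => h (c + x)) x - (oscSet n)ᶜ.indicator h x := fun x =>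
      congrFun (Set.indicator_sub (oscSet n)ᶜ (fun x => h (c + x)) h) x
    simp_rw [this]
    rw [integral_sub hic hi', ← e1, e2]
    ring
  rw [e3, norm_mul]
  have e4 : ‖∫ x, (oscSet n)ᶜ.indicator (fun x => h (c + x) - h x) x‖ ≤
      ∫ x, ‖h (c + x) - h x‖ := by
    refine norm_integral_le_of_norm_le ((hh.comp_add_left c).sub hh).norm (.of_forall fun x => ?_)
    exact norm_indicator_le_norm_self (fun x => h (c + x) - h x) x
  have h5 : ‖(1 / 2 : ℝ)‖ ≤ 1 := by norm_num
  nlinarith [norm_nonneg (∫ x, (oscSet n)ᶜ.indicator (fun x => h (c + x) - h x) x)]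

/-- Multiplication of `N` by the indicator function of `oscSet n`. -/
def oscMul (n : ℕ) (N : L2I) : L2I :=
  ((Lp.memLp N).indicator (measurableSet_oscSet n)).toLp _

theorem coeFn_oscMul (n : ℕ) (N : L2I) :
    oscMul n N =ᵐ[volume.restrict (Set.Ioo 0 1)] (oscSet n).indicator N :=
  MemLp.coeFn_toLp _

theorem oscMul_mem_L2Z (n : ℕ) {N : L2I} (hN : N ∈ L2Z) : oscMul n N ∈ L2Z := by
  change ∀ᵐ x ∂(volume.restrict (Set.Ioo (0 : ℝ) 1)), ∃ k : ℤ, (oscMul n N : ℝ → ℝ) x = k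
  have hN' : ∀ᵐ x ∂(volume.restrict (Set.Ioo (0 : ℝ) 1)), ∃ k : ℤ, (N : ℝ → ℝ) x = k := hN
  filter_upwards [coeFn_oscMul n N, hN'] with x hx ⟨k, hk⟩
  rw [hx]
  by_cases h : x ∈ oscSet n
  · exact ⟨k, by rw [Set.indicator_of_mem h, hk]⟩
  · exact ⟨0, by rw [Set.indicator_of_notMem h, Int.cast_zero]⟩

theorem weakConv_add_smul_oscMul (M N : L2I) (c : ℝ) :
    WeakConv (fun n => M + c • oscMul n N) (M + (c / 2) • N) := by
  rw [weakConv_iff_inner]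
  intro y
  have hI : Integrable (fun x => inner ℝ ((y : ℝ → ℝ) x) ((N : ℝ → ℝ) x))
      (volume.restrict (Set.Ioo (0 : ℝ) 1)) := L2.integrable_inner y N
  set h : ℝ → ℝ := (Set.Ioo (0 : ℝ) 1).indicator
    (fun x => inner ℝ ((y : ℝ → ℝ) x) ((N : ℝ → ℝ) x)) with hdef
  have hh : Integrable h := (integrable_indicator_iff measurableSet_Ioo).2 hI
  have e1 : ∀ n, inner ℝ y (oscMul n N) = ∫ x, (oscSet n).indicator h x := by
    intro n
    have : (oscSet n).indicator h = (Set.Ioo (0 : ℝ) 1).indicator ((oscSet n).indicator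
        (fun x => inner ℝ ((y : ℝ → ℝ) x) ((N : ℝ → ℝ) x))) := by
      rw [hdef, Set.indicator_indicator, Set.indicator_indicator, Set.inter_comm]
    rw [this, integral_indicator measurableSet_Ioo, L2.inner_def]
    refine integral_congr_ae ?_
    filter_upwards [coeFn_oscMul n N] with x hx
    rw [hx]
    by_cases h : x ∈ oscSet n
    · rw [Set.indicator_of_mem h, Set.indicator_of_mem h]
    · rw [Set.indicator_of_notMem h, Set.indicator_of_notMem h, inner_zero_right]
  have e2 : inner ℝ y N = ∫ x, h x := by
    rw [hdef, integral_indicator measurableSet_Ioo, L2.inner_def]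
  have := (tendsto_integral_indicator_oscSet hh).const_mul c
  simp only [inner_add_right, inner_smul_right, e1, e2]
  refine tendsto_const_nhds.add ?_
  convert this using 2
  ring

/-- Take `N = ⌊c M⌋`; the error is `c⁻¹` times a fractional part. -/
theorem exists_L2Z_norm_sub_le (M : L2I) {c : ℝ} (hc : 0 < c) :
    ∃ N ∈ L2Z, ‖M - c⁻¹ • N‖ ≤ c⁻¹ := by
  set ν := volume.restrict (Set.Ioo (0 : ℝ) 1) with hν
  have : IsProbabilityMeasure ν := ⟨by simp [hν]⟩
  have hM : MemLp (fun x => c * (M : ℝ → ℝ) x) 2 ν := (Lp.memLp M).const_mul c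
  have hm : AEStronglyMeasurable (fun x => ((⌊c * (M : ℝ → ℝ) x⌋ : ℤ) : ℝ)) ν := by
    have h1 : Measurable fun y : ℝ => ((⌊y⌋ : ℤ) : ℝ) :=
      (measurable_of_countable (fun k : ℤ => (k : ℝ))).comp Int.measurable_floor
    exact (h1.comp_aemeasurable hM.1.aemeasurable).aestronglyMeasurable
  have hf : MemLp (fun x => Int.fract (c * (M : ℝ → ℝ) x)) 2 ν := by
    refine MemLp.of_bound (hM.1.sub hm) 1 (.of_forall fun x => ?_)
    rw [Real.norm_of_nonneg (Int.fract_nonneg _)]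
    exact (Int.fract_lt_one _).le
  have hN : MemLp (fun x => ((⌊c * (M : ℝ → ℝ) x⌋ : ℤ) : ℝ)) 2 ν := by
    refine (hM.sub hf).ae_eq (.of_forall fun x => ?_)
    simp [Int.self_sub_fract]
  refine ⟨hN.toLp, ?_, ?_⟩
  · change ∀ᵐ x ∂ν, ∃ k : ℤ, (hN.toLp _ : ℝ → ℝ) x = k
    filter_upwards [hN.coeFn_toLp] with x hx
    exact ⟨_, hx⟩
  · have hb : ∀ᵐ x ∂ν, ‖(M - c⁻¹ • hN.toLp _ : L2I) x‖ ≤ c⁻¹ := by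
      filter_upwards [hN.coeFn_toLp, Lp.coeFn_sub M (c⁻¹ • hN.toLp _),
        Lp.coeFn_smul c⁻¹ (hN.toLp _)] with x h1 h2 h3
      rw [h2, Pi.sub_apply, h3, Pi.smul_apply, h1, smul_eq_mul]
      have : (M : ℝ → ℝ) x - c⁻¹ * (⌊c * (M : ℝ → ℝ) x⌋ : ℤ) =
          c⁻¹ * Int.fract (c * (M : ℝ → ℝ) x) := by
        rw [Int.fract, mul_sub, inv_mul_cancel_left₀ hc.ne']
      rw [this, norm_mul, Real.norm_of_nonneg (inv_nonneg.2 hc.le),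
        Real.norm_of_nonneg (Int.fract_nonneg _)]
      exact mul_le_of_le_one_right (inv_nonneg.2 hc.le) (Int.fract_lt_one _).le
    have := Lp.norm_le_of_ae_bound (inv_nonneg.2 hc.le) hb
    have hu : measureUnivNNReal ν = 1 := by
      rw [← ENNReal.coe_inj, coe_measureUnivNNReal, measure_univ, ENNReal.coe_one]
    rwa [hu, NNReal.coe_one, Real.one_rpow, one_mul] at this

/-- Apply the inequality at level `k` to the integer-valued `oscMul n N`, whose weak limit is `N /
2`, and use upper semicontinuity. -/
theorem Periodic.le_add_smul {W : L2I → ℝ} (hWusc : WeaklyUSC W) (hP : Periodic W) (k : ℕ) :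
    ∀ M : L2I, ∀ N ∈ L2Z, W M ≤ W (M + ((1 / 2 : ℝ) ^ k) • N) := by
  induction k with
  | zero =>
    intro M N hN
    rw [pow_zero, one_smul, hP M N hN]
  | succ k ih =>
    intro M N hN
    have hw := weakConv_add_smul_oscMul M N ((1 / 2 : ℝ) ^ k)
    rw [pow_succ, mul_one_div]
    by_contra! hc
    obtain ⟨n, hn⟩ := (hWusc.eventually_lt hw hc).exists
    exact hn.not_ge (ih M _ (oscMul_mem_L2Z n hN))

/-- A periodic weakly upper semicontinuous continuous functional is bounded: integer-valued
functions are weakly dense, so `W 0` is its minimum. -/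
theorem Periodic.exists_bound {W : L2I → ℝ} (hWc : Continuous W) (hWusc : WeaklyUSC W)
    (hP : Periodic W) : ∃ K : ℝ, ∀ M, |W M| ≤ K := by
  have hlow : ∀ M, W 0 ≤ W M := by
    intro M
    choose N hN hNle using fun k : ℕ => exists_L2Z_norm_sub_le M (c := 2 ^ k) (by positivity)
    have hpow : Tendsto (fun k : ℕ => ((2 : ℝ) ^ k)⁻¹) atTop (𝓝 0) := by
      simpa only [inv_pow] using
        tendsto_pow_atTop_nhds_zero_of_lt_one (r := (2 : ℝ)⁻¹) (by norm_num) (by norm_num)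
    have hlim : Tendsto (fun k => ((2 : ℝ) ^ k)⁻¹ • N k) atTop (𝓝 M) := by
      rw [tendsto_iff_norm_sub_tendsto_zero]
      refine squeeze_zero (fun _ => norm_nonneg _) (fun k => ?_) hpow
      rw [norm_sub_rev]
      exact hNle k
    refine ge_of_tendsto' ((hWc.tendsto M).comp hlim) fun k => ?_
    have := hP.le_add_smul hWusc k 0 (N k) (hN k)
    rwa [zero_add, one_div, inv_pow] at this
  have : Fact ((2 : ENNReal) ≠ ⊤) := ⟨by norm_num⟩
  obtain ⟨K, hK⟩ := hWusc.bddAbove_of_norm_le 1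
  have hup : ∀ M, W M ≤ K := by
    intro M
    -- Subtracting the integer part leaves a representative in the unit ball with the same value of
    -- `W`.
    obtain ⟨N, hN, hle⟩ := exists_L2Z_norm_sub_le M one_pos
    rw [inv_one, one_smul] at hle
    have := hP (M - N) N hN
    rw [sub_add_cancel] at this
    rw [this]
    exact hK _ hle
  refine ⟨max K (-W 0), fun M => abs_le.2 ⟨?_, (hup M).trans (le_max_left _ _)⟩⟩
  linarith [hlow M, le_max_right K (-W 0)]

end Periodic

end WeakKAM

end

theorem theorem6p4 (W : WeakKAM.L2I → ℝ) (hWc : Continuous W) (hWusc : WeakKAM.WeaklyUSC W)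
    (hW : (WeakKAM.Periodic W ∧ WeakKAM.RearrangementInvariant W) ∨ (∃ K : ℝ, ∀ M, |W M| ≤ K))
    (u : WeakKAM.L2I → ℝ) (hu : WeakKAM.WeaklyLSC u) (lam : ℝ)
    (hfix : ∀ t : ℝ, 0 ≤ t → ∀ M : WeakKAM.L2I,
      (u M : EReal) =
        WeakKAM.laxOleinik W t (fun N => (u N : EReal)) M + ((lam * t : ℝ) : EReal)) :
    WeakKAM.Dominated W lam u ∧
      ∀ M : WeakKAM.L2I, ∃ σ : ℝ → WeakKAM.L2I, σ 0 = M ∧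
        (∀ t : ℝ, 0 ≤ t → WeakKAM.AC2 (-t) 0 σ) ∧
        ∀ t : ℝ, 0 ≤ t →
          u M - u (σ (-t)) = WeakKAM.action W (-t) 0 σ + lam * t := by
  have : Fact ((2 : ENNReal) ≠ ⊤) := ⟨by norm_num⟩
  obtain ⟨K, hK⟩ : ∃ K : ℝ, ∀ M, |W M| ≤ K := hW.elim (fun h => h.1.exists_bound hWc hWusc) id
  have hD := WeakKAM.dominated_of_laxOleinik hfix
  exact ⟨hD, WeakKAM.exists_calibrated_of_unit hD hWc fun M =>
    WeakKAM.exists_calibrated_unit hWc hWusc hK hu hfix⟩
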